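/- Let $\Lambda$ be a finite discrete alphabet and let $X\subset\Lambda^{\mathbb Z}$ (two-sided case) or $X\subset\Lambda^{\mathbb N_0}$ (one-sided case) be a subshift, i.e. a closed set invariant under the action of $\mathbb Z$ (resp. $\mathbb N_0$) by the shift $(\sigma x)(i)=x(i+1)$. Let $\mathcal B^*(X)$ be the set of all finite blocks $B=x(i)x(i+1)\cdots x(i+k-1)$ occurring in elements $x\in X$ (with $|B|=k$ denoting the length), let $\mathcal M(X)$ be the set of Borel probability measures on $X$, and let $\mathcal M^{\mathrm{erg}}_\sigma(X)\subset\mathcal M(X)$ be the set of ergodic $\sigma$-invariant ones. For $C\in\Lambda^l$, $l\ge 1$, and a block $B$ of length $k$ let $$\mathrm{Fr}_B(C)=\frac{|\{i\in[0,k-l]:\ B|_{[i,i+l)}=C\}|}{k}\quad\text{if } l\le k,\qquad \mathrm{Fr}_B(C)=0\quad\text{if } l>k,$$ and for $\mu\in\mathcal M(X)$ let $\mathrm{Fr}_\mu(C)=\mu([C])$, where $[C]=\{x\in X: x|_{[0,l)}=C\}$. Equip the disjoint union $\mathcal B^*(X)\cup\mathcal M(X)$ with the topology given by the (pseudo)metric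 $$d^*(p,q)=\sum_{l=1}^{\infty}2^{-l}\sum_{C\in\Lambda^l}|\mathrm{Fr}_p(C)-\mathrm{Fr}_q(C)|.$$ Let $\mathcal U$ be an open subset of $\mathcal B^*(X)\cup\mathcal M(X)$ containing $\mathcal M^{\mathrm{erg}}_\sigma(X)$. A block $B\in\mathcal B^*(X)$ is called $\mathcal U$-ergodic if $B\in\mathcal U$. Theorem. For every $\varepsilon>0$ there exists $n_0\in\mathbb N$ such that every block $B\in\mathcal B^*(X)$ of length at least $n_0$ can be written, for some $r\ge1$, as a concatenation of blocks $$B=A_1B_1A_2B_2\cdots A_rB_rA_{r+1},$$ where the blocks $B_1,\dots,B_r$ are nonempty and $\mathcal U$-ergodic, the blocks $A_1,\dots,A_{r+1}$ may be empty, and $$\sum_{j=1}^{r}|B_j|\ \ge\ (1-\varepsilon)\,|B|.$$ -/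

import Mathlib

noncomputable section

namespace ErgodicBlocks

open MeasureTheory SymbolicDynamics.FullShift

/-! Finite blocks over the alphabet `Λ` are elements of `List Λ`; the blocks of a prescribed
length `l` are also written as functions `Fin l → Λ`. The time set `G` is `ℤ` for two-sided
and `ℕ` for one-sided subshifts. -/

section Frequency

variable {Λ : Type*}

/-- The frequency of occurrences of `C` in `B`: the number of positions `i ∈ [0, |B| - l]` at which
`C` occurs in `B`, divided by `|B|`. It is `0` if `l > |B|`. -/
def freq (B : List Λ) {l : ℕ} (C : Fin l → Λ) : ℝ :=
  ({i : ℕ | i + l ≤ B.length ∧ ∀ j : Fin l, B[i + (j : ℕ)]? = some (C j)}.ncard : ℝ) / B.length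

theorem freq_nonneg (B : List Λ) {l : ℕ} (C : Fin l → Λ) : 0 ≤ freq B C := by
  unfold freq; positivity

theorem sum_freq_le_one [Fintype Λ] (B : List Λ) (l : ℕ) :
    ∑ C : Fin (l + 1) → Λ, freq B C ≤ 1 := by
  classical
  have key : ∀ C : Fin (l + 1) → Λ,
      ({i : ℕ | i + (l + 1) ≤ B.length ∧
        ∀ j : Fin (l + 1), B[i + (j : ℕ)]? = some (C j)}.ncard : ℝ)
      = ∑ i ∈ Finset.range B.length, if (i + (l + 1) ≤ B.length ∧
        ∀ j : Fin (l + 1), B[i + (j : ℕ)]? = some (C j)) then (1 : ℝ) else 0 := by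
    intro C
    rw [Finset.sum_boole, ← Set.ncard_coe_finset]
    congr 2
    ext i
    simp only [Set.mem_ofPred_eq, Finset.coe_filter, Finset.mem_range]
    constructor
    · rintro ⟨h1, h2⟩
      exact ⟨by omega, h1, h2⟩
    · rintro ⟨_, h⟩
      exact h
  unfold freq
  rw [← Finset.sum_div]
  refine div_le_one_of_le₀ ?_ (by positivity)
  rw [Finset.sum_congr rfl (fun C _ => key C), Finset.sum_comm]
  calc _ ≤ ∑ _i ∈ Finset.range B.length, (1 : ℝ) := by
        refine Finset.sum_le_sum fun i _ => ?_
        rw [Finset.sum_boole]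
        have : (Finset.univ.filter fun C : Fin (l + 1) → Λ => i + (l + 1) ≤ B.length ∧
            ∀ j : Fin (l + 1), B[i + (j : ℕ)]? = some (C j)).card ≤ 1 := by
          rw [Finset.card_le_one]
          intro a ha b hb
          simp only [Finset.mem_filter, Finset.mem_univ, true_and] at ha hb
          funext j
          have := (ha.2 j).symm.trans (hb.2 j)
          simpa using this
        exact_mod_cast this
    _ = B.length := by simp

end Frequency

section Subshift

variable {Λ : Type*} [TopologicalSpace Λ] {G : Type*} [AddMonoidWithOne G]

/-- The set of all blocks occurring, at some position, in some element of the subshift `X`. -/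
def language (X : Subshift Λ G) : Set (List Λ) :=
  {B | ∃ x ∈ X.carrier, ∃ i : G, ∀ j : Fin B.length, x (i + ((j : ℕ) : G)) = B.get j}

/-- The cylinder in `X` associated with the block `C`. -/
def blockCylinder (X : Subshift Λ G) {l : ℕ} (C : Fin l → Λ) : Set X.carrier :=
  {x | ∀ j : Fin l, (x : G → Λ) ((j : ℕ) : G) = C j}

/-- The shift transformation of the subshift `X`. -/
def shiftMap (X : Subshift Λ G) : X.carrier → X.carrier :=
  (X.mapsTo 1).restrict (SymbolicDynamics.FullShift.shift (1 : G)) X.carrier X.carrier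

variable [MeasurableSpace Λ]

/-- The disjoint union of the set of blocks occurring in `X` and of the set of
all Borel probability measures on `X`. -/
inductive BlockOrMeasure (X : Subshift Λ G) : Type _
  | block (B : language X) : BlockOrMeasure X
  | meas (μ : ProbabilityMeasure X.carrier) : BlockOrMeasure X

/-- The value at a block `C`: the frequency of `C` in a block, or the measure of the cylinder. -/
def BlockOrMeasure.weight {X : Subshift Λ G} {l : ℕ} (C : Fin l → Λ) : BlockOrMeasure X → ℝ
  | .block B => freq (B : List Λ) C
  | .meas μ => (μ : Measure X.carrier).real (blockCylinder X C)

/-- The distance `d*` between blocks and/or measures; the `l`-th term concerns blocks of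
length `l + 1`, so that the sum extends over all lengths `≥ 1`. -/
def dStar [Fintype Λ] {X : Subshift Λ G} (p q : BlockOrMeasure X) : ℝ :=
  ∑' l : ℕ, (1 / 2 : ℝ) ^ (l + 1) * ∑ C : Fin (l + 1) → Λ, |p.weight C - q.weight C|

theorem weight_nonneg {X : Subshift Λ G} (p : BlockOrMeasure X) {l : ℕ} (C : Fin l → Λ) :
    0 ≤ p.weight C := by
  cases p with
  | block B => exact freq_nonneg _ _
  | meas μ => exact measureReal_nonneg

variable [DiscreteTopology Λ] [BorelSpace Λ]

theorem measurableSet_blockCylinder (X : Subshift Λ G) {l : ℕ} (C : Fin l → Λ) :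
    MeasurableSet (blockCylinder X C) := by
  have : blockCylinder X C =
      ⋂ j : Fin l, (fun x : X.carrier => (x : G → Λ) ((j : ℕ) : G)) ⁻¹' {C j} := by
    ext x; simp [blockCylinder]
  rw [this]
  refine MeasurableSet.iInter fun j => ?_
  exact ((measurable_pi_apply _).comp measurable_subtype_coe)
    (isClosed_discrete _).measurableSet

variable [Fintype Λ]

theorem sum_weight_le_one {X : Subshift Λ G} (p : BlockOrMeasure X) (l : ℕ) :
    ∑ C : Fin (l + 1) → Λ, p.weight C ≤ 1 := by
  cases p with
  | block B => exact sum_freq_le_one _ _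
  | meas μ =>
    have h := sum_measureReal_le_measureReal_univ (μ := (μ : Measure X.carrier))
      (s := Finset.univ) (t := fun C : Fin (l + 1) → Λ => blockCylinder X C)
      (fun C _ => measurableSet_blockCylinder X C)
      (fun C _ D _ hCD => by
        refine Set.disjoint_left.2 fun x hx hy => hCD ?_
        funext j
        exact (hx j).symm.trans (hy j))
    exact h.trans_eq probReal_univ

theorem summable_dStar {X : Subshift Λ G} (p q : BlockOrMeasure X) :
    Summable fun l : ℕ =>
      (1 / 2 : ℝ) ^ (l + 1) * ∑ C : Fin (l + 1) → Λ, |p.weight C - q.weight C| := by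
  have hs : Summable fun l : ℕ => (1 / 2 : ℝ) ^ l := summable_geometric_two
  refine hs.of_nonneg_of_le (fun l => by positivity) fun l => ?_
  have h : ∑ C : Fin (l + 1) → Λ, |p.weight C - q.weight C| ≤ 2 := by
    calc _ ≤ ∑ C : Fin (l + 1) → Λ, (p.weight C + q.weight C) := by
          refine Finset.sum_le_sum fun C _ => ?_
          have h1 := weight_nonneg p C
          have h2 := weight_nonneg q C
          rw [abs_le]
          constructor <;> linarith
      _ ≤ 2 := by
          rw [Finset.sum_add_distrib]
          linarith [sum_weight_le_one p l, sum_weight_le_one q l]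
  calc _ ≤ (1 / 2 : ℝ) ^ (l + 1) * 2 := by gcongr
    _ = (1 / 2 : ℝ) ^ l := by ring

/-- The topology on the set of blocks and measures is the one given by `d*`. -/
instance instPseudoMetricSpace (X : Subshift Λ G) : PseudoMetricSpace (BlockOrMeasure X) where
  dist := dStar
  dist_self p := by simp [dStar]
  dist_comm p q := by simp [dStar, abs_sub_comm]
  dist_triangle p q r := by
    unfold dStar
    rw [← (summable_dStar p q).tsum_add (summable_dStar q r)]
    refine (summable_dStar p r).tsum_le_tsum (fun l => ?_)
      ((summable_dStar p q).add (summable_dStar q r))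
    rw [← mul_add, ← Finset.sum_add_distrib]
    gcongr
    exact abs_sub_le _ _ _

/-- `U` contains every ergodic shift-invariant measure on `X`. -/
def ContainsErgodicMeasures {X : Subshift Λ G} (U : Set (BlockOrMeasure X)) : Prop :=
  ∀ μ : ProbabilityMeasure X.carrier,
    Ergodic (shiftMap X) (μ : Measure X.carrier) → BlockOrMeasure.meas μ ∈ U

/-- A block is `U`-ergodic if it occurs in `X` and belongs to `U`. -/
def IsErgodicBlock {X : Subshift Λ G} (U : Set (BlockOrMeasure X)) (B : List Λ) : Prop :=
  ∃ h : B ∈ language X, BlockOrMeasure.block ⟨B, h⟩ ∈ U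

/-- `B = A₁B₁A₂B₂ … AᵣBᵣAᵣ₊₁` with `r ≥ 1`, where the blocks `Bⱼ` are nonempty and `U`-ergodic and
`∑ |Bⱼ| ≥ (1 - ε)|B|`; the blocks `Aⱼ` may be empty. -/
def HasErgodicDecomposition {X : Subshift Λ G} (U : Set (BlockOrMeasure X)) (ε : ℝ)
    (B : List Λ) : Prop :=
  ∃ (r : ℕ) (A : Fin (r + 1) → List Λ) (E : Fin r → List Λ),
    1 ≤ r ∧
    B = (List.ofFn fun j : Fin r => A j.castSucc ++ E j).flatten ++ A (Fin.last r) ∧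
    (∀ j, E j ≠ [] ∧ IsErgodicBlock U (E j)) ∧
    (1 - ε) * (B.length : ℝ) ≤ ∑ j, ((E j).length : ℝ)

end Subshift

end ErgodicBlocks

end

/-! Suppose arbitrarily long blocks fail to decompose. Choosing good blocks greedily from left to
right covers every position at which some `U`-ergodic block starts (`exists_greedy_blocks`), so in a
failing block at least a proportion `ε` of positions start none. Realise these blocks along orbits
in `X`: for each fixed `N` the orbits eventually spend a fraction at least `ε / 2` of their time in
the closed set `nonergodicUpTo U N`. A weak limit of the empirical measures is invariant and gives
each of these sets mass at least `ε / 2` (`exists_invariant_measure_ge`), hence also their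
decreasing intersection `K`. Some ergodic `ν` then charges `K` (`exists_ergodic_measure_pos`). But
for large `n` the mean ergodic theorem gives most `ν`-points an initial `n`-block with frequencies
close to `ν`, hence in `U`; so `ν K = 0` (`measure_iInter_nonergodicUpTo`), a contradiction. Only
nonnegative shifts of a point are iterated, so `ℤ` and `ℕ` are treated together. -/

noncomputable section
namespace ErgodicBlocks

open MeasureTheory Filter Topology
open scoped ENNReal BoundedContinuousFunction

section EmpiricalMeasure

variable {X : Type*} [MeasurableSpace X]

/-- The uniform probability measure on the orbit segment `x, T x, …, T^(n-1) x`. -/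
def empiricalMeasure (T : X → X) (x : X) (n : ℕ) (hn : n ≠ 0) : ProbabilityMeasure X :=
  ⟨(n : ℝ≥0∞)⁻¹ • ∑ j ∈ Finset.range n, Measure.dirac (T^[j] x), ⟨by
    simp [ENNReal.inv_mul_cancel (Nat.cast_ne_zero.2 hn) (ENNReal.natCast_ne_top n)]⟩⟩

theorem integral_empiricalMeasure (T : X → X) (x : X) {n : ℕ} (hn : n ≠ 0) {f : X → ℝ}
    (hf : StronglyMeasurable f) :
    ∫ y, f y ∂(empiricalMeasure T x n hn : Measure X) = birkhoffAverage ℝ T f n x := by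
  have h := integral_finsetSum_measure (f := f) (s := Finset.range n)
    (μ := fun j => Measure.dirac (T^[j] x)) fun j _ =>
      (integrable_dirac' hf (by simp))
  rw [empiricalMeasure, ProbabilityMeasure.coe_mk, integral_smul_measure, h]
  simp [birkhoffAverage, birkhoffSum, integral_dirac' _ _ hf]

end EmpiricalMeasure

/-! ### Invariant and ergodic measures on compact spaces -/

section Dynamics

variable {X : Type*} [TopologicalSpace X] [MeasurableSpace X] [BorelSpace X]

/-- The integrals of bounded continuous functions with respect to a probability measure. -/
def integralVector (μ : ProbabilityMeasure X) : (X →ᵇ ℝ) → ℝ :=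
  fun f => ∫ x, f x ∂(μ : Measure X)

/-- With injectivity below, this carries compact sets of measures into a locally convex real space,
where they have extreme points. -/
theorem continuous_integralVector : Continuous (integralVector (X := X)) :=
  continuous_pi fun f => continuous_iff_continuousAt.2 fun _ =>
    (ProbabilityMeasure.tendsto_iff_forall_integral_tendsto.1 tendsto_id) f

/-- The difference telescopes to two boundary terms divided by `n k`. -/
theorem tendsto_integral_empiricalMeasure_comp_sub {T : X → X} (hT : Continuous T) (f : X →ᵇ ℝ)
    (x : ℕ → X) (n : ℕ → ℕ) (hn0 : ∀ k, n k ≠ 0) (hn : Tendsto n atTop atTop) :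
    Tendsto (fun k => ∫ y, f (T y) ∂(empiricalMeasure T (x k) (n k) (hn0 k) : Measure X) -
      ∫ y, f y ∂(empiricalMeasure T (x k) (n k) (hn0 k) : Measure X)) atTop (𝓝 0) := by
  have hlim : Tendsto (fun k => 2 * ‖f‖ / (n k : ℝ)) atTop (𝓝 0) :=
    tendsto_const_nhds.div_atTop (tendsto_natCast_atTop_atTop.comp hn)
  refine squeeze_zero_norm (fun k => ?_) hlim
  rw [integral_empiricalMeasure _ _ _ f.continuous.stronglyMeasurable,
    integral_empiricalMeasure (f := fun y => f (T y)) _ _ _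
      (f.continuous.comp hT).stronglyMeasurable]
  have : birkhoffAverage ℝ T (fun y => f (T y)) (n k) (x k) =
      birkhoffAverage ℝ T f (n k) (T (x k)) := by
    simp only [birkhoffAverage, birkhoffSum, ← Function.iterate_succ_apply' T,
      ← Function.iterate_succ_apply]
  rw [this, birkhoffAverage_apply_sub_birkhoffAverage, norm_smul, norm_inv, Real.norm_natCast,
    inv_mul_eq_div]
  gcongr
  rw [← dist_eq_norm]
  exact f.dist_le_two_norm _ _

variable [TopologicalSpace.MetrizableSpace X]

theorem upperSemicontinuous_measure {K : Set X} (hK : IsClosed K) :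
    UpperSemicontinuous fun μ : ProbabilityMeasure X => (μ : Measure X) K := by
  intro μ
  refine upperSemicontinuousAt_iff_limsup_le.2 ?_
  exact ProbabilityMeasure.limsup_measure_closed_le_of_tendsto tendsto_id hK

theorem isClosed_invariantMeasures {T : X → X} (hT : Continuous T) :
    IsClosed {μ : ProbabilityMeasure X | MeasurePreserving T (μ : Measure X) μ} := by
  have : {μ : ProbabilityMeasure X | MeasurePreserving T (μ : Measure X) μ} =
      {μ | μ.map hT.measurable.aemeasurable = μ} := by
    ext μ
    constructor
    · intro h
      exact Subtype.ext h.map_eq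
    · intro h
      exact ⟨hT.measurable, congrArg Subtype.val h⟩
  rw [this]
  exact isClosed_eq (ProbabilityMeasure.continuous_map hT) continuous_id

theorem integralVector_injective : Function.Injective (integralVector (X := X)) :=
  fun μ ν h => Subtype.ext <| ext_of_forall_integral_eq_of_IsFiniteMeasure (μ := (μ : Measure X))
    (ν := (ν : Measure X)) fun f => congrFun h f

/-- If a closed set has positive measure for some invariant measure, then it does so for some
ergodic measure. -/
theorem exists_ergodic_measure_pos [CompactSpace X] {T : X → X} (hT : Continuous T) {K : Set X}
    (hK : IsClosed K) (μ : ProbabilityMeasure X) (hμ : MeasurePreserving T (μ : Measure X) μ)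
    (hμK : 0 < (μ : Measure X) K) :
    ∃ ν : ProbabilityMeasure X, Ergodic T (ν : Measure X) ∧ 0 < (ν : Measure X) K := by
  set S := {μ : ProbabilityMeasure X | MeasurePreserving T (μ : Measure X) μ} with hS
  have hSc : IsCompact S := (isClosed_invariantMeasures hT).isCompact
  obtain ⟨μ₀, hμ₀, hmax⟩ := UpperSemicontinuousOn.exists_isMaxOn (s := S) ⟨μ, hμ⟩ hSc
    ((upperSemicontinuous_measure hK).upperSemicontinuousOn S)
  set c := (μ₀ : Measure X) K with hc
  have hcpos : 0 < c := hμK.trans_le (hmax hμ)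
  -- The maximisers of the mass of `K` form a face of the invariant measures, so an extreme point of
  -- `M` is extreme in `S`, that is, ergodic.
  set M := S ∩ {μ : ProbabilityMeasure X | c ≤ (μ : Measure X) K}
  have hMc : IsCompact M :=
    hSc.inter_right ((upperSemicontinuous_measure hK).isClosed_preimage c)
  obtain ⟨_, ⟨ν, hνM, rfl⟩, hext⟩ := (hMc.image continuous_integralVector).extremePoints_nonempty
    ⟨_, μ₀, ⟨hμ₀, le_refl c⟩, rfl⟩
  refine ⟨ν, Ergodic.of_mem_extremePoints ?_, hcpos.trans_le hνM.2⟩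
  refine ⟨⟨hνM.1, inferInstance⟩, ?_⟩
  rintro ν₁ ⟨h₁, hp₁⟩ ν₂ ⟨h₂, hp₂⟩ ⟨a, b, ha, hb, hab, hν⟩
  have hat : a ≠ ∞ := ne_top_of_le_ne_top ENNReal.one_ne_top (hab ▸ le_self_add)
  have hbt : b ≠ ∞ := ne_top_of_le_ne_top ENNReal.one_ne_top (hab ▸ le_add_self)
  let p₁ : ProbabilityMeasure X := ⟨ν₁, hp₁⟩
  let p₂ : ProbabilityMeasure X := ⟨ν₂, hp₂⟩
  have hle₁ : ν₁ K ≤ c := hmax (a := p₁) h₁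
  have hle₂ : ν₂ K ≤ c := hmax (a := p₂) h₂
  have hνK : c ≤ a * ν₁ K + b * ν₂ K := by
    have h := hνM.2
    rw [Set.mem_ofPred_eq, ← hν] at h
    simpa using h
  have hct : c ≠ ∞ := measure_ne_top _ _
  have hsplit : a * c + b * c = c := by rw [← add_mul, hab, one_mul]
  -- Both masses are at most `c` and their weighted mean is at least `c`, so both components lie in
  -- `M`.
  have hge₁ : c ≤ ν₁ K := by
    by_contra! hlt
    have : a * ν₁ K + b * ν₂ K < a * c + b * c :=
      ENNReal.add_lt_add_of_lt_of_le (ENNReal.mul_ne_top hbt (measure_ne_top _ _))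
        ((ENNReal.mul_lt_mul_iff_right ha.ne' hat).2 hlt) (by gcongr)
    exact (hνK.trans_lt this).ne hsplit.symm
  have hge₂ : c ≤ ν₂ K := by
    by_contra! hlt
    have : a * ν₁ K + b * ν₂ K < a * c + b * c :=
      ENNReal.add_lt_add_of_le_of_lt (ENNReal.mul_ne_top hat (measure_ne_top _ _))
        (by gcongr) ((ENNReal.mul_lt_mul_iff_right hb.ne' hbt).2 hlt)
    exact (hνK.trans_lt this).ne hsplit.symm
  have hseg : integralVector ν ∈ openSegment ℝ (integralVector p₁) (integralVector p₂) := by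
    refine ⟨a.toReal, b.toReal, ENNReal.toReal_pos ha.ne' hat, ENNReal.toReal_pos hb.ne' hbt,
      ?_, ?_⟩
    · rw [← ENNReal.toReal_add hat hbt, hab, ENNReal.toReal_one]
    · funext f
      have hi : ∀ (ρ : Measure X) [IsProbabilityMeasure ρ], Integrable (fun x => f x) ρ :=
        fun ρ _ => f.integrable ρ
      simp only [integralVector, Pi.add_apply, Pi.smul_apply, smul_eq_mul]
      rw [← hν, integral_add_measure ((hi ν₁).smul_measure hat) ((hi ν₂).smul_measure hbt),
        integral_smul_measure, integral_smul_measure]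
      rfl
  have := hext ⟨p₁, ⟨h₁, hge₁⟩, rfl⟩ ⟨p₂, ⟨h₂, hge₂⟩, rfl⟩ hseg
  exact congrArg Subtype.val (integralVector_injective this)

/-- Limits of empirical measures along orbit segments of growing length are invariant and charge
closed sets that are visited often. -/
theorem exists_invariant_measure_ge [CompactSpace X] {T : X → X} (hT : Continuous T)
    (x : ℕ → X) (n : ℕ → ℕ) (hn : Tendsto n atTop atTop) (K : ℕ → Set X)
    (hK : ∀ N, IsClosed (K N)) (c : ℝ)
    (h : ∀ N, ∀ᶠ k in atTop, c ≤ birkhoffAverage ℝ T ((K N).indicator 1) (n k) (x k)) :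
    ∃ μ : ProbabilityMeasure X, MeasurePreserving T (μ : Measure X) μ ∧
      ∀ N, ENNReal.ofReal c ≤ (μ : Measure X) (K N) := by
  obtain ⟨k₀, hk₀⟩ := eventually_atTop.1 (hn.eventually_ge_atTop 1)
  have hn0 : ∀ k, n (k + k₀) ≠ 0 := fun k => by
    have := hk₀ (k + k₀) (by omega)
    omega
  set μs : ℕ → ProbabilityMeasure X :=
    fun k => empiricalMeasure T (x (k + k₀)) (n (k + k₀)) (hn0 k) with hμs
  have hn' : Tendsto (fun k => n (k + k₀)) atTop atTop := hn.comp (tendsto_add_atTop_nat k₀)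
  -- A limit along an ultrafilter finer than `atTop` replaces the choice of a convergent
  -- subsequence.
  obtain ⟨μ, -, hμ⟩ := isCompact_univ.ultrafilter_le_nhds ((hyperfilter ℕ).map μs) (by simp)
  have hlim : Tendsto μs (hyperfilter ℕ) (𝓝 μ) := hμ
  have hle : (hyperfilter ℕ : Filter ℕ) ≤ atTop := Nat.hyperfilter_le_atTop
  refine ⟨μ, ⟨hT.measurable, ?_⟩, fun N => ?_⟩
  · have : IsProbabilityMeasure ((μ : Measure X).map T) :=
      Measure.isProbabilityMeasure_map hT.measurable.aemeasurable
    refine ext_of_forall_integral_eq_of_IsFiniteMeasure fun f => ?_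
    rw [integral_map hT.measurable.aemeasurable f.continuous.aestronglyMeasurable]
    have h1 := ProbabilityMeasure.tendsto_iff_forall_integral_tendsto.1 hlim f
    have h2 := ProbabilityMeasure.tendsto_iff_forall_integral_tendsto.1 hlim
      (f.compContinuous ⟨T, hT⟩)
    have h3 := (tendsto_integral_empiricalMeasure_comp_sub hT f (fun k => x (k + k₀))
      (fun k => n (k + k₀)) hn0 hn').mono_left hle
    exact sub_eq_zero.1 (tendsto_nhds_unique (h2.sub h1) h3)
  · refine le_trans ?_ (ProbabilityMeasure.limsup_measure_closed_le_of_tendsto hlim (hK N))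
    refine le_limsup_of_frequently_le (Eventually.frequently ?_)
    refine hle ?_
    filter_upwards [(tendsto_add_atTop_nat k₀).eventually (h N)] with k hk
    refine ENNReal.ofReal_le_of_le_toReal ?_
    change c ≤ (μs k : Measure X).real (K N)
    rw [← integral_indicator_one (hK N).measurableSet, hμs,
      integral_empiricalMeasure _ _ _ (stronglyMeasurable_one.indicator (hK N).measurableSet)]
    exact hk

end Dynamics

/-! ### The mean ergodic theorem -/

/-- The mean ergodic theorem: frequencies of visits to a measurable set converge in measure. -/
theorem tendstoInMeasure_birkhoffAverage_indicator {X : Type*} [MeasurableSpace X] {T : X → X}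
    {ν : Measure X} [IsProbabilityMeasure ν] (hT : Ergodic T ν) {A : Set X}
    (hA : MeasurableSet A) :
    TendstoInMeasure ν (fun n x => birkhoffAverage ℝ T (A.indicator 1) n x) atTop
      (fun _ => ν.real A) := by
  have hmp : MeasurePreserving T ν ν := hT.toMeasurePreserving
  let V := Lp.compMeasurePreservingₗᵢ (E := ℝ) (p := 2) ℝ T hmp
  let W : Lp ℝ 2 ν →L[ℝ] Lp ℝ 2 ν := V.toContinuousLinearMap
  let g : Lp ℝ 2 ν := indicatorConstLp 2 hA (measure_ne_top ν A) (1 : ℝ)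
  let one : Lp ℝ 2 ν := indicatorConstLp 2 MeasurableSet.univ (measure_ne_top ν _) (1 : ℝ)
  have hlim := W.tendsto_birkhoffAverage_orthogonalProjection
    V.norm_toContinuousLinearMap_le g
  set P := (W.eqLocus (1 : Lp ℝ 2 ν →L[ℝ] Lp ℝ 2 ν)).orthogonalProjectionOnto g with hP
  have hm := tendstoInMeasure_of_tendsto_Lp hlim
  have hone : one ∈ W.eqLocus (1 : Lp ℝ 2 ν →L[ℝ] Lp ℝ 2 ν) := by
    exact Lp.indicatorConstLp_compMeasurePreserving MeasurableSet.univ _ _ hmp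
  have hPc : ∃ c : ℝ, (P : Lp ℝ 2 ν) =ᵐ[ν] fun _ => c := by
    have h1 : W P = P := P.2
    refine hT.ae_eq_const_of_ae_eq_comp_ae (Lp.aestronglyMeasurable _) ?_
    have h2 := Lp.coeFn_compMeasurePreserving (P : Lp ℝ 2 ν) hmp
    have h3 : Lp.compMeasurePreserving T hmp (P : Lp ℝ 2 ν) = P := h1
    rw [h3] at h2
    exact h2.symm
  obtain ⟨c, hc⟩ := hPc
  -- The constant `one` is invariant, so projecting `g` onto the invariant functions preserves its
  -- integral.
  have hcA : c = ν.real A := by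
    have h0 : inner ℝ one (g - (P : Lp ℝ 2 ν)) = 0 :=
      (Submodule.mem_orthogonal _ _).1 (Submodule.sub_starProjection_mem_orthogonal g) one hone
    rw [inner_sub_right, sub_eq_zero, L2.inner_indicatorConstLp_one,
      L2.inner_indicatorConstLp_one, setIntegral_univ, setIntegral_univ, integral_congr_ae hc,
      integral_congr_ae indicatorConstLp_coeFn, integral_indicator hA] at h0
    simpa using h0.symm
  subst hcA
  refine hm.congr (fun n => ?_) hc
  have hiter : ∀ k, W^[k] g = Lp.compMeasurePreserving T^[k] (hmp.iterate k) g := fun k =>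
    congrFun (Lp.compMeasurePreserving_iterate hmp k) g
  have hk : ∀ᵐ x ∂ν, ∀ k, (W^[k] g : Lp ℝ 2 ν) x = A.indicator 1 (T^[k] x) := by
    refine ae_all_iff.2 fun k => ?_
    rw [hiter k, Lp.indicatorConstLp_compMeasurePreserving]
    filter_upwards [indicatorConstLp_coeFn (p := 2) (hs := hA.preimage (hmp.iterate k).measurable)
      (hμs := measure_ne_top ν _) (c := (1 : ℝ))] with x hx
    rw [hx]
    rfl
  simp only [birkhoffAverage, birkhoffSum, id]
  filter_upwards [hk, Lp.coeFn_smul (n : ℝ)⁻¹ (∑ k ∈ Finset.range n, W^[k] g),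
    Lp.coeFn_fun_finsetSum (Finset.range n) fun k => W^[k] g] with x h1 h2 h3
  rw [h2, Pi.smul_apply, h3]
  simp only [h1]

end ErgodicBlocks
end

noncomputable section
namespace ErgodicBlocks

/-! ### Greedy selection of disjoint blocks -/

section Greedy

variable {Λ : Type*} (P : List Λ → Prop)

/-- A nonempty initial segment of `S` satisfies `P`. -/
def HasGoodPrefix (S : List Λ) : Prop :=
  ∃ m, 0 < m ∧ m ≤ S.length ∧ P (S.take m)

open Classical in
/-- The number of positions of `S` at which some nonempty block satisfying `P` occurs. -/
def goodCount (S : List Λ) : ℕ :=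
  ((Finset.range S.length).filter fun i => HasGoodPrefix P (S.drop i)).card

open Classical in
theorem goodCount_cons (a : Λ) (S : List Λ) :
    goodCount P (a :: S) = goodCount P S + if HasGoodPrefix P (a :: S) then 1 else 0 := by
  simp only [goodCount, Finset.card_filter, List.length_cons, Finset.sum_range_succ',
    List.drop_succ_cons, List.drop_zero]

theorem goodCount_le_add_goodCount_drop (S : List Λ) (m : ℕ) :
    goodCount P S ≤ m + goodCount P (S.drop m) := by
  induction m generalizing S with
  | zero => simp
  | succ m ih =>
    cases S with
    | nil => simp [goodCount]
    | cons a S =>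
      rw [goodCount_cons, List.drop_succ_cons]
      have := ih S
      split_ifs <;> omega

/-- Disjoint blocks satisfying `P`, chosen greedily from left to right, cover all positions at
which such a block occurs. -/
theorem exists_greedy_blocks (S : List Λ) :
    ∃ (D : List (List Λ × List Λ)) (R : List Λ),
      S = (D.map fun d => d.1 ++ d.2).flatten ++ R ∧
      (∀ d ∈ D, d.2 ≠ [] ∧ P d.2) ∧
      goodCount P S ≤ (D.map fun d => d.2.length).sum := by
  induction hn : S.length using Nat.strong_induction_on generalizing S with
  | _ n ih =>
    subst hn
    -- A good prefix of length `m` adds `m` to the covered length and uses up at most `m` good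
    -- positions; otherwise the first letter joins the next gap.
    by_cases hS : HasGoodPrefix P S
    · obtain ⟨m, hm, hmS, hP⟩ := hS
      obtain ⟨D, R, hD, hDP, hc⟩ := ih (S.drop m).length (by simp; omega) (S.drop m) rfl
      refine ⟨([], S.take m) :: D, R, ?_, ?_, ?_⟩
      · simp [← hD]
      · rintro d (_ | ⟨_, hd⟩)
        · refine ⟨fun h => ?_, hP⟩
          have := congrArg List.length h
          simp at this
          grind
        · exact hDP d hd
      · have := goodCount_le_add_goodCount_drop P S m
        simp [hmS]
        omega
    · cases S with
      | nil => exact ⟨[], [], by simp, by simp, by simp [goodCount]⟩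
      | cons a S =>
        obtain ⟨D, R, hD, hDP, hc⟩ := ih S.length (by simp) S rfl
        rw [goodCount_cons, if_neg hS]
        cases D with
        | nil => exact ⟨[], a :: R, by simpa using hD, by simp, by simpa using hc⟩
        | cons d D =>
          refine ⟨(a :: d.1, d.2) :: D, R, by simpa using hD, ?_, by simpa using hc⟩
          rintro e (_ | ⟨_, he⟩)
          · exact hDP d (by simp)
          · exact hDP e (List.mem_cons_of_mem d he)

end Greedy

open SymbolicDynamics.FullShift

/-- Positivity of the count forces at least one greedy block, giving `1 ≤ r`. -/
theorem hasErgodicDecomposition_of_goodCount {Λ : Type*} [TopologicalSpace Λ] {G : Type*}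
    [AddMonoidWithOne G] [MeasurableSpace Λ] {X : Subshift Λ G} (U : Set (BlockOrMeasure X))
    {ε : ℝ} {B : List Λ} (hpos : 0 < goodCount (IsErgodicBlock U) B)
    (hB : (1 - ε) * (B.length : ℝ) ≤ goodCount (IsErgodicBlock U) B) :
    HasErgodicDecomposition U ε B := by
  obtain ⟨D, R, hD, hDP, hc⟩ := exists_greedy_blocks (IsErgodicBlock U) B
  refine ⟨D.length, Fin.snoc (fun j => D[j].1) R, fun j => D[j].2, ?_, ?_, ?_, ?_⟩
  · by_contra! h
    have : D = [] := List.length_eq_zero_iff.1 (by omega)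
    subst this
    simp at hc
    omega
  · simp only [Fin.snoc_castSucc, Fin.snoc_last]
    rw [hD]
    congr 2
    apply List.ext_getElem <;> simp
  · exact fun j => hDP _ (by simp)
  · refine hB.trans ?_
    have : (D.map fun d => d.2.length).sum = ∑ j : Fin D.length, D[j].2.length := by
      rw [← List.sum_ofFn]
      congr 1
      apply List.ext_getElem <;> simp
    rw [this] at hc
    exact_mod_cast hc

end ErgodicBlocks
end

noncomputable section
namespace ErgodicBlocks

open MeasureTheory Filter Topology SymbolicDynamics.FullShift

theorem birkhoffAverage_indicator_one {X : Type*} (T : X → X) (A : Set X)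
    [DecidablePred (· ∈ A)] (n : ℕ) (x : X) :
    birkhoffAverage ℝ T (A.indicator (1 : X → ℝ)) n x =
      ((Finset.range n).filter fun i => T^[i] x ∈ A).card / n := by
  simp [birkhoffAverage, birkhoffSum, Set.indicator_apply, inv_mul_eq_div]

/-! ### Blocks as initial segments of orbits -/

section Symbolic

variable {Λ : Type*} [TopologicalSpace Λ] {G : Type*} [AddMonoidWithOne G]

/-- The block `x(0) x(1) … x(n-1)`. -/
def initialBlock (x : G → Λ) (n : ℕ) : List Λ :=
  List.ofFn fun j : Fin n => x ((j : ℕ) : G)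

omit [TopologicalSpace Λ] in
@[simp]
theorem length_initialBlock (x : G → Λ) (n : ℕ) : (initialBlock x n).length = n := by
  simp [initialBlock]

omit [TopologicalSpace Λ] in
theorem getElem?_initialBlock (x : G → Λ) {n i : ℕ} (h : i < n) :
    (initialBlock x n)[i]? = some (x (i : G)) := by
  simp [initialBlock, h]

variable {X : Subshift Λ G}

theorem shiftMap_iterate_apply (k : ℕ) (x : X.carrier) (g : G) :
    ((shiftMap X)^[k] x : G → Λ) g = (x : G → Λ) ((k : G) + g) := by
  induction k generalizing x with
  | zero => simp
  | succ k ih =>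
    rw [Function.iterate_succ_apply, ih]
    change (x : G → Λ) (1 + (k + g)) = _
    rw [← add_assoc]
    rw [← Nat.cast_one, ← Nat.cast_add, Nat.add_comm]

theorem continuous_shiftMap : Continuous (shiftMap X) :=
  ((continuous_shift (1 : G)).comp continuous_subtype_val).subtype_mk _

theorem initialBlock_mem_language (x : X.carrier) (n : ℕ) :
    initialBlock (x : G → Λ) n ∈ language X :=
  ⟨x, x.2, 0, fun j => by
    rw [zero_add, List.get_eq_getElem]
    simp [initialBlock]⟩

theorem exists_initialBlock_eq {B : List Λ} (hB : B ∈ language X) :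
    ∃ x : X.carrier, initialBlock (x : G → Λ) B.length = B := by
  obtain ⟨x, hx, i, h⟩ := hB
  refine ⟨⟨shift i x, X.mapsTo i hx⟩, ?_⟩
  simp only [initialBlock, shift_apply, h]
  exact List.ofFn_get B

theorem take_drop_initialBlock (x : X.carrier) {n i m : ℕ} (h : i + m ≤ n) :
    ((initialBlock (x : G → Λ) n).drop i).take m =
      initialBlock ((shiftMap X)^[i] x : G → Λ) m := by
  refine List.ext_getElem (by simp; omega) fun j hj _ => ?_
  simp [initialBlock, shiftMap_iterate_apply]

/-- The two counts differ only at the last positions, where `C` would overrun the block. The case `l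
= 0` fails: the empty block occurs at `n + 1` positions. -/
theorem abs_freq_initialBlock_sub_le (x : X.carrier) (n : ℕ) {l : ℕ} (hl : 0 < l)
    (C : Fin l → Λ) :
    |freq (initialBlock (x : G → Λ) n) C -
      birkhoffAverage ℝ (shiftMap X) ((blockCylinder X C).indicator 1) n x| ≤ l / n := by
  classical
  set s := (Finset.range n).filter fun i => (shiftMap X)^[i] x ∈ blockCylinder X C with hs
  have h1 := birkhoffAverage_indicator_one (shiftMap X) (blockCylinder X C) n x
  have h2 : freq (initialBlock (x : G → Λ) n) C = (s.filter fun i => i + l ≤ n).card / n := by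
    rw [freq, ← Set.ncard_coe_finset, length_initialBlock]
    rcases Nat.eq_zero_or_pos n with rfl | hn
    · simp
    congr 3
    ext i
    simp only [Set.mem_ofPred_eq, Finset.coe_filter, hs, Finset.mem_filter, Finset.mem_range]
    constructor
    · rintro ⟨hi, hC⟩
      refine ⟨⟨by omega, fun j => ?_⟩, hi⟩
      have h := hC j
      rw [getElem?_initialBlock _ (by omega), Nat.cast_add] at h
      rw [shiftMap_iterate_apply]
      exact Option.some_injective _ h
    · rintro ⟨⟨-, hC⟩, hi⟩
      refine ⟨hi, fun j => ?_⟩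
      rw [getElem?_initialBlock _ (by omega), ← hC j, shiftMap_iterate_apply, Nat.cast_add]
  have h3 : (s.filter fun i => i + l ≤ n).card ≤ s.card := Finset.card_filter_le _ _
  have h4 : s.card ≤ (s.filter fun i => i + l ≤ n).card + l := by
    rw [← Finset.card_filter_add_card_filter_not (s := s) fun i => i + l ≤ n]
    gcongr
    calc _ ≤ (Finset.Ico (n - l) n).card := by
          refine Finset.card_le_card fun i hi => ?_
          simp [hs] at hi
          simp
          omega
      _ ≤ l := by
          rw [Nat.card_Ico]
          omega
  rw [h1, h2, ← hs, ← sub_div, abs_div, Nat.abs_cast]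
  gcongr
  rw [abs_le]
  have h3' : ((s.filter fun i => i + l ≤ n).card : ℝ) ≤ s.card := by exact_mod_cast h3
  have h4' : (s.card : ℝ) ≤ (s.filter fun i => i + l ≤ n).card + l := by exact_mod_cast h4
  constructor <;> linarith

theorem hasErgodicDecomposition_mono [MeasurableSpace Λ] {U : Set (BlockOrMeasure X)}
    {ε ε' : ℝ} (h : ε ≤ ε') {B : List Λ} (hB : HasErgodicDecomposition U ε B) : HasErgodicDecomposition U ε' B := by
  obtain ⟨r, A, E, h1, h2, h3, h4⟩ := hB
  refine ⟨r, A, E, h1, h2, h3, le_trans ?_ h4⟩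
  gcongr

variable [DiscreteTopology Λ] [MeasurableSpace Λ]

/-- The points none of whose nonempty initial blocks of length at most `N` is `U`-ergodic. -/
def nonergodicUpTo (U : Set (BlockOrMeasure X)) (N : ℕ) : Set X.carrier :=
  {x | ∀ m, 0 < m → m ≤ N → ¬ IsErgodicBlock U (initialBlock (x : G → Λ) m)}

/-- Membership depends on finitely many coordinates. Closedness lets mass survive in weak limits. -/
theorem isClosed_nonergodicUpTo (U : Set (BlockOrMeasure X)) (N : ℕ) :
    IsClosed (nonergodicUpTo U N) := by
  simp only [nonergodicUpTo, Set.ofPred_forall]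
  refine isClosed_iInter fun m => isClosed_iInter fun _ => isClosed_iInter fun _ => ?_
  have hc : Continuous fun x : X.carrier => fun j : Fin m => (x : G → Λ) ((j : ℕ) : G) :=
    continuous_pi fun j => (continuous_apply _).comp continuous_subtype_val
  exact (isClosed_discrete {f : Fin m → Λ | ¬ IsErgodicBlock U (List.ofFn f)}).preimage hc

-- Each position is good, or among the last `N`, or visits `nonergodicUpTo U N`: elsewhere an
-- ergodic block of length at most `N` still fits.
omit [DiscreteTopology Λ] in
theorem length_le_goodCount_add (U : Set (BlockOrMeasure X)) (N : ℕ) (x : X.carrier) (n : ℕ) :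
    (n : ℝ) ≤ goodCount (IsErgodicBlock U) (initialBlock (x : G → Λ) n) + N +
      n * birkhoffAverage ℝ (shiftMap X) ((nonergodicUpTo U N).indicator 1) n x := by
  classical
  rcases Nat.eq_zero_or_pos n with rfl | hn
  · simp
    positivity
  set bad := (Finset.range n).filter fun i => (shiftMap X)^[i] x ∈ nonergodicUpTo U N with hbad
  rw [birkhoffAverage_indicator_one, mul_div_cancel₀ _ (by positivity : (n : ℝ) ≠ 0), ← hbad]
  set good := (Finset.range n).filter fun i =>
    HasGoodPrefix (IsErgodicBlock U) ((initialBlock (x : G → Λ) n).drop i) with hgood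
  have hg : goodCount (IsErgodicBlock U) (initialBlock (x : G → Λ) n) = good.card := by
    simp only [goodCount, length_initialBlock, hgood]
  have hsub : Finset.range n ⊆ good ∪ Finset.Ico (n - N) n ∪ bad := by
    intro i hi
    rw [Finset.mem_range] at hi
    simp only [Finset.mem_union, Finset.mem_Ico]
    by_cases h : n - N ≤ i
    · exact .inl (.inr ⟨h, hi⟩)
    by_cases hb : (shiftMap X)^[i] x ∈ nonergodicUpTo U N
    · exact .inr (Finset.mem_filter.2 ⟨Finset.mem_range.2 hi, hb⟩)
    simp only [nonergodicUpTo, Set.mem_ofPred_eq, not_forall, not_not] at hb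
    obtain ⟨m, hm, hmN, he⟩ := hb
    refine .inl (.inl (Finset.mem_filter.2 ⟨Finset.mem_range.2 hi, m, hm, ?_, ?_⟩))
    · simp; omega
    · rwa [take_drop_initialBlock x (by omega)]
  have hcard := Finset.card_le_card hsub
  have h2 := Finset.card_union_le (good ∪ Finset.Ico (n - N) n) bad
  have h3 := Finset.card_union_le good (Finset.Ico (n - N) n)
  rw [Nat.card_Ico] at h3
  rw [Finset.card_range] at hcard
  rw [hg]
  have : n ≤ good.card + N + bad.card := by omega
  exact_mod_cast this

variable [BorelSpace Λ] [Fintype Λ]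

/-- Points whose weights are close on finitely many blocks are close. -/
theorem exists_forall_weight_imp_dist_lt (q : BlockOrMeasure X) {r : ℝ} (hr : 0 < r) :
    ∃ (L : ℕ) (δ : ℝ), 0 < δ ∧ ∀ p : BlockOrMeasure X,
      (∀ l < L, ∀ C : Fin (l + 1) → Λ, |p.weight C - q.weight C| < δ) → dist p q < r := by
  -- Weights of each length sum to at most `1`, so the tail is at most `2 * (1 / 2) ^ L < r / 2`;
  -- `δ` keeps the head within `r / 2`.
  obtain ⟨L, hL⟩ := exists_pow_lt_of_lt_one (show 0 < r / 4 by positivity)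
    (show (1 / 2 : ℝ) < 1 by norm_num)
  obtain ⟨M, hMdef⟩ : ∃ M : ℝ, M =
      ∑ l ∈ Finset.range L, (1 / 2 : ℝ) ^ (l + 1) * Fintype.card (Fin (l + 1) → Λ) := ⟨_, rfl⟩
  have hM : 0 ≤ M := by rw [hMdef]; positivity
  refine ⟨L, r / 2 / (M + 1), by positivity, fun p hp => ?_⟩
  change dStar p q < r
  have hsum := summable_dStar p q
  rw [dStar, ← hsum.sum_add_tsum_nat_add L]
  have hhead : ∑ l ∈ Finset.range L,
      (1 / 2 : ℝ) ^ (l + 1) * ∑ C : Fin (l + 1) → Λ, |p.weight C - q.weight C| ≤ r / 2 := by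
    calc _ ≤ ∑ l ∈ Finset.range L,
          (1 / 2 : ℝ) ^ (l + 1) * Fintype.card (Fin (l + 1) → Λ) * (r / 2 / (M + 1)) := by
          refine Finset.sum_le_sum fun l hl => ?_
          rw [mul_assoc]
          gcongr
          refine (Finset.sum_le_card_nsmul _ _ _ fun C _ =>
            (hp l (Finset.mem_range.1 hl) C).le).trans_eq ?_
          simp
      _ = M * (r / 2 / (M + 1)) := by rw [← Finset.sum_mul, ← hMdef]
      _ ≤ r / 2 := by
          rw [mul_div_assoc', div_le_iff₀ (by positivity)]
          nlinarith
  have htail : ∑' l : ℕ, (1 / 2 : ℝ) ^ (l + L + 1) *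
      ∑ C : Fin (l + L + 1) → Λ, |p.weight C - q.weight C| ≤ (1 / 2 : ℝ) ^ L * 2 := by
    have hgeom : ∑' l : ℕ, (1 / 2 : ℝ) ^ L * (1 / 2 : ℝ) ^ l = (1 / 2 : ℝ) ^ L * 2 := by
      rw [tsum_mul_left, tsum_geometric_two]
    rw [← hgeom]
    refine ((summable_nat_add_iff L).2 hsum).tsum_le_tsum (fun l => ?_)
      (summable_geometric_two.mul_left _)
    calc _ ≤ (1 / 2 : ℝ) ^ (l + L + 1) * 2 := by
          gcongr
          calc _ ≤ ∑ C : Fin (l + L + 1) → Λ, (p.weight C + q.weight C) := by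
                refine Finset.sum_le_sum fun C _ => ?_
                have h1 := weight_nonneg p C
                have h2 := weight_nonneg q C
                rw [abs_le]
                constructor <;> linarith
            _ ≤ 2 := by
                rw [Finset.sum_add_distrib]
                linarith [sum_weight_le_one p (l + L), sum_weight_le_one q (l + L)]
      _ = _ := by ring
  linarith

/-- Almost every point of an ergodic measure has a `U`-ergodic initial block. -/
theorem measure_iInter_nonergodicUpTo {U : Set (BlockOrMeasure X)} (hU : IsOpen U)
    (hUe : ContainsErgodicMeasures U) (ν : ProbabilityMeasure X.carrier)
    (hν : Ergodic (shiftMap X) (ν : Measure X.carrier)) :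
    (ν : Measure X.carrier) (⋂ N, nonergodicUpTo U N) = 0 := by
  obtain ⟨r, hr, hball⟩ := Metric.isOpen_iff.1 hU _ (hUe ν hν)
  obtain ⟨L, δ, hδ, hclose⟩ := exists_forall_weight_imp_dist_lt (BlockOrMeasure.meas ν) hr
  set bad : (l : ℕ) → (Fin (l + 1) → Λ) → ℕ → Set X.carrier := fun l C n =>
    {x | ENNReal.ofReal (δ / 2) ≤ edist
      (birkhoffAverage ℝ (shiftMap X) ((blockCylinder X C).indicator 1) n x)
      ((ν : Measure X.carrier).real (blockCylinder X C))} with hbad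
  have hlim : Tendsto (fun n => ∑ l ∈ Finset.range L, ∑ C : Fin (l + 1) → Λ,
      (ν : Measure X.carrier) (bad l C n)) atTop (𝓝 0) := by
    have : Tendsto (fun n => ∑ l ∈ Finset.range L, ∑ C : Fin (l + 1) → Λ,
      (ν : Measure X.carrier) (bad l C n)) atTop
        (𝓝 (∑ l ∈ Finset.range L, ∑ C : Fin (l + 1) → Λ, 0)) :=
      tendsto_finsetSum _ fun l _ => tendsto_finsetSum _ fun C _ =>
        tendstoInMeasure_birkhoffAverage_indicator hν (measurableSet_blockCylinder X C) _
          (by simpa using hδ)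
    simpa using this
  have hLn : Tendsto (fun n : ℕ => (L : ℝ) / n) atTop (𝓝 0) :=
    tendsto_const_div_atTop_nhds_zero_nat _
  -- Convergence in measure suffices: a point of the intersection has a nonergodic initial block of
  -- every length `n`, so for each large `n` it lies in some `bad l C n`.
  refine le_antisymm (ge_of_tendsto hlim ?_) zero_le
  filter_upwards [hLn.eventually_lt_const (half_pos hδ), eventually_gt_atTop 0] with n hn hn0
  have hsub : (⋂ N, nonergodicUpTo U N) ⊆
      ⋃ l ∈ Finset.range L, ⋃ C ∈ (Finset.univ : Finset (Fin (l + 1) → Λ)), bad l C n := by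
    intro x hx
    by_contra hxb
    simp only [Finset.mem_range, Finset.mem_univ, Set.iUnion_true, Set.mem_iUnion, not_exists,
      hbad, Set.mem_ofPred_eq, not_le] at hxb
    refine Set.mem_iInter.1 hx n n hn0 le_rfl ⟨initialBlock_mem_language x n, hball ?_⟩
    refine Metric.mem_ball.2 (hclose _ fun l hl C => ?_)
    have h1 := hxb l hl C
    rw [edist_dist, ENNReal.ofReal_lt_ofReal_iff (half_pos hδ), Real.dist_eq] at h1
    have h2 := abs_freq_initialBlock_sub_le x n l.succ_pos C
    have h3 : ((l + 1 : ℕ) : ℝ) / n ≤ L / n := by gcongr; exact_mod_cast hl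
    calc _ ≤ _ := abs_sub_le _
          (birkhoffAverage ℝ (shiftMap X) ((blockCylinder X C).indicator 1) n x) _
      _ < δ / 2 + δ / 2 := add_lt_add ((h2.trans h3).trans_lt hn) h1
      _ = δ := add_halves δ
  refine (measure_mono hsub).trans ((measure_biUnion_finset_le _ _).trans ?_)
  gcongr
  exact measure_biUnion_finset_le _ _

/-- Over any countable time monoid, all long blocks have an ergodic decomposition. -/
theorem exists_forall_hasErgodicDecomposition [Countable G] {U : Set (BlockOrMeasure X)}
    (hU : IsOpen U) (hUe : ContainsErgodicMeasures U) {ε : ℝ} (hε : 0 < ε) :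
    ∃ n₀ : ℕ, ∀ B ∈ language X, n₀ ≤ B.length → HasErgodicDecomposition U ε B := by
  -- With `ε < 1`, a good count exceeding `(1 - ε) * |B|` is automatically positive.
  wlog hε1 : ε < 1 generalizing ε
  · obtain ⟨n₀, h⟩ := this (ε := 1 / 2) (by norm_num) (by norm_num)
    exact ⟨n₀, fun B hB hn => hasErgodicDecomposition_mono (by linarith) (h B hB hn)⟩
  by_contra! hcon
  choose B hB hBlen hBdec using hcon
  choose x hx using fun k => exists_initialBlock_eq (hB k)
  have hlen : Tendsto (fun k => (B k).length) atTop atTop :=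
    tendsto_atTop_mono hBlen tendsto_id
  have hcompact : CompactSpace X.carrier := isCompact_iff_compactSpace.1 X.isClosed.isCompact
  obtain ⟨μ, hμ, hμK⟩ := exists_invariant_measure_ge (continuous_shiftMap (X := X)) x
    (fun k => (B k).length) hlen (nonergodicUpTo U) (isClosed_nonergodicUpTo U) (ε / 2) fun N => by
      have hreal : Tendsto (fun k => ((B k).length : ℝ)) atTop atTop :=
        tendsto_natCast_atTop_atTop.comp hlen
      -- This length makes the `N` boundary positions cost at most half of the proportion `ε`.
      filter_upwards [hreal.eventually_ge_atTop (2 * N / ε), hreal.eventually_gt_atTop 0]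
        with k hk hk0
      have h1 := length_le_goodCount_add U N (x k) (B k).length
      rw [hx k] at h1
      have h2 : (goodCount (IsErgodicBlock U) (B k) : ℝ) ≤ (1 - ε) * (B k).length := by
        by_contra! hlt
        refine hBdec k (hasErgodicDecomposition_of_goodCount U ?_ hlt.le)
        have : (0 : ℝ) ≤ (1 - ε) * (B k).length := by
          have : 0 ≤ 1 - ε := by linarith
          positivity
        exact_mod_cast this.trans_lt hlt
      rw [div_le_iff₀ hε] at hk
      nlinarith
  have hanti : Antitone (nonergodicUpTo U) := fun _ _ h _ hy m hm hmN => hy m hm (hmN.trans h)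
  have hpos : 0 < (μ : Measure X.carrier) (⋂ N, nonergodicUpTo U N) := by
    have hlim := tendsto_measure_iInter_atTop (μ := (μ : Measure X.carrier))
      (fun N => (isClosed_nonergodicUpTo U N).measurableSet.nullMeasurableSet) hanti
      ⟨0, measure_ne_top _ _⟩
    exact (ENNReal.ofReal_pos.2 (half_pos hε)).trans_le
      (ge_of_tendsto hlim (Eventually.of_forall hμK))
  obtain ⟨ν, hν, hνpos⟩ := exists_ergodic_measure_pos continuous_shiftMap
    (isClosed_iInter (isClosed_nonergodicUpTo U)) μ hμ hpos
  exact hνpos.ne' (measure_iInter_nonergodicUpTo hU hUe ν hν)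

end Symbolic

end ErgodicBlocks
end

theorem theorem2p4 {Λ : Type*} [Fintype Λ] [TopologicalSpace Λ] [DiscreteTopology Λ]
    [MeasurableSpace Λ] [BorelSpace Λ] :
    -- two-sided subshifts
    (∀ (X : SymbolicDynamics.FullShift.Subshift Λ ℤ) (U : Set (ErgodicBlocks.BlockOrMeasure X)),
      IsOpen U → ErgodicBlocks.ContainsErgodicMeasures U →
      ∀ ε : ℝ, 0 < ε → ∃ n₀ : ℕ, ∀ B ∈ ErgodicBlocks.language X, n₀ ≤ B.length →
        ErgodicBlocks.HasErgodicDecomposition U ε B) ∧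
    -- one-sided subshifts
    (∀ (X : SymbolicDynamics.FullShift.Subshift Λ ℕ) (U : Set (ErgodicBlocks.BlockOrMeasure X)),
      IsOpen U → ErgodicBlocks.ContainsErgodicMeasures U →
      ∀ ε : ℝ, 0 < ε → ∃ n₀ : ℕ, ∀ B ∈ ErgodicBlocks.language X, n₀ ≤ B.length →
        ErgodicBlocks.HasErgodicDecomposition U ε B) :=
  ⟨fun _ _ hU hUe _ hε => ErgodicBlocks.exists_forall_hasErgodicDecomposition hU hUe hε,
    fun _ _ hU hUe _ hε => ErgodicBlocks.exists_forall_hasErgodicDecomposition hU hUe hε⟩
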